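/- **Notation.** Let $\mathcal K$ be a real Hilbert space. For a set-valued operator $A\colon\mathcal K\to 2^{\mathcal K}$, put $\operatorname{zer}A=\{x: 0\in Ax\}$ and $A^{-1}u=\{x: u\in Ax\}$; the parallel sum is $B\,\square\,D=(B^{-1}+D^{-1})^{-1}$ (sums of sets are Minkowski sums). $A$ is *maximally monotone* if, for all $x,x^*\in\mathcal K$, one has $x^*\in Ax$ if and only if $\langle x-y, x^*-y^*\rangle\ge 0$ for all $y$ and all $y^*\in Ay$; it is *strictly monotone* if $\langle x-y,x^*-y^*\rangle>0$ whenever $x^*\in Ax$, $y^*\in Ay$, $x\ne y$. A map $C\colon\mathcal K\to\mathcal K$ is *cocoercive with constant* $\alpha>0$ if $\langle x-y,Cx-Cy\rangle\ge\alpha\|Cx-Cy\|^2$ for all $x,y$. **Setting.** Let $(\mathcal H_i)_{i\in I}$ and $(\mathcal G_k)_{k\in K}$ be finite families of real Hilbert spaces, $I\ne\varnothing$, with Hilbert direct sums $\mathcal H=\bigoplus_i\mathcal H_i$ and $\mathcal G=\bigoplus_k\mathcal G_k$. For all $i\in I$, $k\in K$ let $s_i^*\in\mathcal H_i$, $r_k\in\mathcal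 G_k$; let $A_i\colon\mathcal H_i\to2^{\mathcal H_i}$ and $B_k^m,D_k^m\colon\mathcal G_k\to 2^{\mathcal G_k}$ be maximally monotone; let $C_i\colon\mathcal H_i\to\mathcal H_i$ and $B_k^c,D_k^c\colon\mathcal G_k\to\mathcal G_k$ be cocoercive; let $Q_i\colon\mathcal H_i\to\mathcal H_i$ and $B_k^l,D_k^l\colon\mathcal G_k\to\mathcal G_k$ be monotone and Lipschitzian; let $L_{ki}\colon\mathcal H_i\to\mathcal G_k$ be bounded and linear; and let $R_i\colon\mathcal H\to\mathcal H_i$ be such that $x\mapsto(R_ix)_{i\in I}$ is monotone and Lipschitzian on $\mathcal H$. Write $B_k=B_k^m+B_k^c+B_k^l$ and $D_k=D_k^m+D_k^c+D_k^l$. Let - $\mathscr P$ be the set of $x\in\mathcal H$ such that $s_i^*\in A_ix_i+C_ix_i+Q_ix_i+R_ix+\sum_{k\in K}L_{ki}^*\big((B_k\,\square\,D_k)(\sum_{j\in I}L_{kj}x_j-r_k)\big)$ for every $i\in I$; - $\mathscr D$ be the set of $v^*\in\mathcal G$ for which there is $x\in\mathcal H$ with $s_i^*-\sum_{k\in K}L_{ki}^*v_k^*\in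 A_ix_i+C_ix_i+Q_ix_i+R_ix$ for every $i\in I$ and $v_k^*\in(B_k\,\square\,D_k)(\sum_{j\in I}L_{kj}x_j-r_k)$ for every $k\in K$; - $\mathsf Z$ be the set of $(x,v^*)\in\mathcal H\oplus\mathcal G$ such that $s_i^*-\sum_{k\in K}L_{ki}^*v_k^*\in A_ix_i+C_ix_i+Q_ix_i+R_ix$ for every $i\in I$ and $\sum_{j\in I}L_{kj}x_j-r_k\in B_k^{-1}v_k^*+D_k^{-1}v_k^*$ for every $k\in K$ (the Kuhn–Tucker set); - $\mathcal S$ be the saddle operator on $\mathcal H\oplus\mathcal G\oplus\mathcal G\oplus\mathcal G$ that maps $(x,y,z,v^*)$ to the product set $$\prod_{i\in I}\Big(-s_i^*+A_ix_i+C_ix_i+Q_ix_i+R_ix+\sum_{k\in K}L_{ki}^*v_k^*\Big)\times\prod_{k\in K}(B_ky_k-v_k^*)\times\prod_{k\in K}(D_kz_k-v_k^*)\times\prod_{k\in K}\Big\{r_k+y_k+z_k-\sum_{i\in I}L_{ki}x_i\Big\}.$$ **Proposition.** The following hold. (i) $\mathcal S$ is maximally monotone. (ii) $\operatorname{zer}\mathcal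 S$ is closed and convex. (iii) If $(x,y,z,v^*)\in\operatorname{zer}\mathcal S$, then $(x,v^*)\in\mathsf Z$; moreover $\mathsf Z\subset\mathscr P\times\mathscr D$. (iv) $\mathscr D\ne\varnothing\Leftrightarrow\operatorname{zer}\mathcal S\ne\varnothing\Leftrightarrow\mathsf Z\ne\varnothing\Rightarrow\mathscr P\ne\varnothing$. (v) Suppose that one of the following holds: [a] $I$ is a singleton; [b] for every $k\in K$, $B_k\,\square\,D_k$ is at most single-valued; [c] for every $k\in K$, $D_k^{-1}$ is strictly monotone; [d] $I$ is (identified through an injection with) a subset of $K$, $B_k\,\square\,D_k$ is at most single-valued for every $k\in K\smallsetminus I$, and $L_{ki}=0$ for all $i,k\in I$ with $k\ne i$. Then $\mathscr P\ne\varnothing\Rightarrow\mathsf Z\ne\varnothing$. -/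

import Mathlib

open scoped Pointwise

noncomputable section

/-! ### Set-valued operators on a real Hilbert space -/

namespace SetOp

/-- The set of zeros of `A : E → 2^F`. -/
def zer {E F : Type*} [Zero F] (A : E → Set F) : Set E :=
  {x | 0 ∈ A x}

/-- The inverse of `A : E → 2^F`. -/
def inverse {E F : Type*} (A : E → Set F) : F → Set E :=
  fun u => {x | u ∈ A x}

/-- A single-valued map seen as a set-valued operator. -/
def ofMap {E F : Type*} (C : E → F) : E → Set F :=
  fun x => {C x}

/-- The parallel sum `(B⁻¹ + D⁻¹)⁻¹`, where `+` is the pointwise Minkowski sum. -/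
def parallelSum {E F : Type*} [Add E] (B D : E → Set F) : E → Set F :=
  inverse (inverse B + inverse D)

/-- Every value has at most one element (values may be empty). -/
def AtMostSingleValued {E F : Type*} (A : E → Set F) : Prop :=
  ∀ x, (A x).Subsingleton

section Hilbert

variable {E : Type*} [NormedAddCommGroup E] [InnerProductSpace ℝ E]

/-- Maximal monotonicity: `(x, u)` is in the graph of `A` exactly when it is monotonically related
to every point of the graph. -/
def MaximallyMonotone (A : E → Set E) : Prop :=
  ∀ x u : E, u ∈ A x ↔ ∀ y v : E, v ∈ A y → 0 ≤ inner ℝ (x - y) (u - v)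

/-- Strict monotonicity of a set-valued operator. -/
def StrictlyMonotone (A : E → Set E) : Prop :=
  ∀ x u y v : E, u ∈ A x → v ∈ A y → x ≠ y → 0 < inner ℝ (x - y) (u - v)

/-- Monotonicity of a single-valued map `C : E → E`. -/
def MonotoneMap (C : E → E) : Prop :=
  ∀ x y : E, 0 ≤ inner ℝ (x - y) (C x - C y)

/-- Cocoercivity of `C : E → E` with constant `α > 0`. -/
def Cocoercive (α : ℝ) (C : E → E) : Prop :=
  0 < α ∧ ∀ x y : E, α * ‖C x - C y‖ ^ 2 ≤ inner ℝ (x - y) (C x - C y)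

end Hilbert

end SetOp

/-! ### The system of monotone inclusions

`PiLp 2 H` and `PiLp 2 G` are the Hilbert direct sums of the families `H` and `G`. -/

/-- The data of the primal-dual system of monotone inclusions, with their standing properties. -/
structure InclusionSystem {I K : Type*} [Fintype I] [Fintype K]
    (H : I → Type*) [∀ i, NormedAddCommGroup (H i)] [∀ i, InnerProductSpace ℝ (H i)]
    (G : K → Type*) [∀ k, NormedAddCommGroup (G k)] [∀ k, InnerProductSpace ℝ (G k)] where
  s : ∀ i, H i
  r : ∀ k, G k
  A : ∀ i, H i → Set (H i)
  C : ∀ i, H i → H i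
  Q : ∀ i, H i → H i
  R : ∀ i, PiLp 2 H → H i
  Bm : ∀ k, G k → Set (G k)
  Bc : ∀ k, G k → G k
  Bl : ∀ k, G k → G k
  Dm : ∀ k, G k → Set (G k)
  Dc : ∀ k, G k → G k
  Dl : ∀ k, G k → G k
  L : ∀ k i, H i →L[ℝ] G k
  αc : I → ℝ
  αl : I → NNReal
  βc : K → ℝ
  βl : K → NNReal
  δc : K → ℝ
  δl : K → NNReal
  χ : NNReal
  A_maximallyMonotone : ∀ i, SetOp.MaximallyMonotone (A i)
  C_cocoercive : ∀ i, SetOp.Cocoercive (αc i) (C i)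
  Q_monotone : ∀ i, SetOp.MonotoneMap (Q i)
  Q_lipschitz : ∀ i, LipschitzWith (αl i) (Q i)
  Bm_maximallyMonotone : ∀ k, SetOp.MaximallyMonotone (Bm k)
  Bc_cocoercive : ∀ k, SetOp.Cocoercive (βc k) (Bc k)
  Bl_monotone : ∀ k, SetOp.MonotoneMap (Bl k)
  Bl_lipschitz : ∀ k, LipschitzWith (βl k) (Bl k)
  Dm_maximallyMonotone : ∀ k, SetOp.MaximallyMonotone (Dm k)
  Dc_cocoercive : ∀ k, SetOp.Cocoercive (δc k) (Dc k)
  Dl_monotone : ∀ k, SetOp.MonotoneMap (Dl k)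
  Dl_lipschitz : ∀ k, LipschitzWith (δl k) (Dl k)
  R_monotone : SetOp.MonotoneMap (fun x : PiLp 2 H => WithLp.toLp 2 (fun i => R i x))
  R_lipschitz : LipschitzWith χ (fun x : PiLp 2 H => WithLp.toLp 2 (fun i => R i x))

namespace InclusionSystem

variable {I K : Type*} [Fintype I] [Fintype K]
  {H : I → Type*} [∀ i, NormedAddCommGroup (H i)] [∀ i, InnerProductSpace ℝ (H i)]
  {G : K → Type*} [∀ k, NormedAddCommGroup (G k)] [∀ k, InnerProductSpace ℝ (G k)]

/-- `A_i x_i + C_i x_i + Q_i x_i + R_i x`, as a subset of `H i`. -/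
def primalOp (M : InclusionSystem H G) (x : PiLp 2 H) (i : I) : Set (H i) :=
  M.A i (x i) + {M.C i (x i)} + {M.Q i (x i)} + {M.R i x}

/-- `Bᵐ_k + Bᶜ_k + Bˡ_k`. -/
def B (M : InclusionSystem H G) (k : K) : G k → Set (G k) :=
  M.Bm k + SetOp.ofMap (M.Bc k) + SetOp.ofMap (M.Bl k)

/-- `Dᵐ_k + Dᶜ_k + Dˡ_k`. -/
def D (M : InclusionSystem H G) (k : K) : G k → Set (G k) :=
  M.Dm k + SetOp.ofMap (M.Dc k) + SetOp.ofMap (M.Dl k)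

/-- `∑ j, L_kj x_j`. -/
def sumL (M : InclusionSystem H G) (x : PiLp 2 H) (k : K) : G k :=
  ∑ j, M.L k j (x j)

/-- The Hilbert direct sum `H ⊕ G ⊕ G ⊕ G`; its points are written
`⟨x, y, z, v⟩` with `x = p.fst`, `y = p.snd.fst`, `z = p.snd.snd.fst`, `v = p.snd.snd.snd`. -/
abbrev SaddleSpace (H : I → Type*) [∀ i, NormedAddCommGroup (H i)]
    [∀ i, InnerProductSpace ℝ (H i)]
    (G : K → Type*) [∀ k, NormedAddCommGroup (G k)] [∀ k, InnerProductSpace ℝ (G k)] :=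
  WithLp 2 (PiLp 2 H × WithLp 2 (PiLp 2 G × WithLp 2 (PiLp 2 G × PiLp 2 G)))

variable [∀ i, CompleteSpace (H i)] [∀ k, CompleteSpace (G k)]

/-- `∑ k, L_ki^* v_k`. -/
def sumLAdj (M : InclusionSystem H G) (v : PiLp 2 G) (i : I) : H i :=
  ∑ k, ContinuousLinearMap.adjoint (M.L k i) (v k)

/-- The set of solutions of the primal problem. The sum over `k` is a Minkowski sum of sets. -/
def primalSolutions (M : InclusionSystem H G) : Set (PiLp 2 H) :=
  {x | ∀ i, M.s i ∈ M.primalOp x i +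
    ∑ k, ContinuousLinearMap.adjoint (M.L k i) ''
      SetOp.parallelSum (M.B k) (M.D k) (M.sumL x k - M.r k)}

/-- The set of solutions of the dual problem. -/
def dualSolutions (M : InclusionSystem H G) : Set (PiLp 2 G) :=
  {v | ∃ x : PiLp 2 H, (∀ i, M.s i - M.sumLAdj v i ∈ M.primalOp x i) ∧
    ∀ k, v k ∈ SetOp.parallelSum (M.B k) (M.D k) (M.sumL x k - M.r k)}

/-- The Kuhn–Tucker set, as a set of pairs `(x, v)`. -/
def kuhnTucker (M : InclusionSystem H G) : Set (PiLp 2 H × PiLp 2 G) :=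
  {p | (∀ i, M.s i - M.sumLAdj p.2 i ∈ M.primalOp p.1 i) ∧
    ∀ k, M.sumL p.1 k - M.r k ∈
      SetOp.inverse (M.B k) (p.2 k) + SetOp.inverse (M.D k) (p.2 k)}

/-- The saddle operator on `H ⊕ G ⊕ G ⊕ G`: `q` belongs to its value at `p = (x, y, z, v)` when
each component of `q` belongs to the corresponding factor of the product set. -/
def saddle (M : InclusionSystem H G) (p : SaddleSpace H G) : Set (SaddleSpace H G) :=
  let x := p.fst
  let y := p.snd.fst
  let z := p.snd.snd.fst
  let v := p.snd.snd.snd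
  {q | (∀ i, q.fst i ∈ {-M.s i} + M.primalOp x i + {M.sumLAdj v i}) ∧
    (∀ k, q.snd.fst k ∈ M.B k (y k) + {-v k}) ∧
    (∀ k, q.snd.snd.fst k ∈ M.D k (z k) + {-v k}) ∧
    ∀ k, q.snd.snd.snd k = M.r k + y k + z k - M.sumL x k}

end InclusionSystem

end

namespace SetOp

/-! The saddle operator is a Hilbert product of maximally monotone operators plus a single-valued
map `coupling` that gathers `R` and the terms in `L`, `L*`, `s`, `r`. In the monotonicity inner
product the skew linear terms cancel (`inner_coupling_sub`), so only `R` remains: the coupling is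
monotone and one-sided Lipschitzian, and `add_singleton` preserves maximality. That perturbation
result rests on Minty's theorem, proved by minimizing the Fitzpatrick function plus half the squared
norm. Zeros of a maximally monotone operator form an intersection of closed half-spaces, hence a
closed convex set.

The links between zeros, Kuhn–Tucker points and dual solutions amount to naming the intermediate
`y`, `z` in the parallel sum. A primal solution falls short of a Kuhn–Tucker point only because its
dual vector may depend on `i`; each of the conditions [a]–[d] removes this dependence
(`kuhnTucker_nonempty_of_selection`). -/

theorem inner_eq_fst_add_snd {E F : Type*} [NormedAddCommGroup E] [InnerProductSpace ℝ E]
    [NormedAddCommGroup F] [InnerProductSpace ℝ F] (p q : WithLp 2 (E × F)) :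
    inner ℝ p q = inner ℝ p.fst q.fst + inner ℝ p.snd q.snd :=
  WithLp.prod_inner_apply p q

/-! ### Minimizing a supremum of affine functions plus a quadratic -/

section Minimization

variable {F : Type*} [NormedAddCommGroup F] [InnerProductSpace ℝ F] [CompleteSpace F]

/-- A supremum of affine functions plus `½‖·‖²`, if proper and bounded below, has a minimizer. The
values are recorded through upper bounds, so that the supremum may be infinite. -/
theorem exists_minimizer_sup_affine {ι : Type*} (b : ι → F) (c : ι → ℝ) (m₀ : ℝ)
    (hne : ∃ p t, ∀ a, inner ℝ p (b a) + c a + ‖p‖ ^ 2 / 2 ≤ t)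
    (hbd : ∀ p t, (∀ a, inner ℝ p (b a) + c a + ‖p‖ ^ 2 / 2 ≤ t) → m₀ ≤ t) :
    ∃ p t, (∀ a, inner ℝ p (b a) + c a + ‖p‖ ^ 2 / 2 ≤ t) ∧
      ∀ q s, (∀ a, inner ℝ q (b a) + c a + ‖q‖ ^ 2 / 2 ≤ s) → t ≤ s := by
  set S : Set ℝ := {t | ∃ p, ∀ a, inner ℝ p (b a) + c a + ‖p‖ ^ 2 / 2 ≤ t} with hS
  have hSne : S.Nonempty := by
    obtain ⟨p, t, h⟩ := hne
    exact ⟨t, p, h⟩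
  have hSbd : BddBelow S := ⟨m₀, by rintro t ⟨p, h⟩; exact hbd p t h⟩
  set m := sInf S
  have hm : ∀ q s, (∀ a, inner ℝ q (b a) + c a + ‖q‖ ^ 2 / 2 ≤ s) → m ≤ s :=
    fun q s h => csInf_le hSbd ⟨q, h⟩
  have hseq : ∀ n : ℕ, ∃ p, ∀ a, inner ℝ p (b a) + c a + ‖p‖ ^ 2 / 2 ≤ m + 1 / ((n : ℝ) + 1) := by
    intro n
    obtain ⟨t, ⟨p, hp⟩, ht⟩ := exists_lt_of_csInf_lt hSne
      (show m < m + 1 / ((n : ℝ) + 1) by linarith [Nat.one_div_pos_of_nat (α := ℝ) (n := n)])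
    exact ⟨p, fun a => (hp a).trans ht.le⟩
  choose p hp using hseq
  have hdist : ∀ N n k : ℕ, N ≤ n → N ≤ k → ‖p n - p k‖ ^ 2 ≤ 8 * (1 / ((N : ℝ) + 1)) := by
    intro N n k hn hk
    have h1 := Nat.one_div_le_one_div (α := ℝ) hn
    have h2 := Nat.one_div_le_one_div (α := ℝ) hk
    -- At the midpoint the affine parts average, while the parallelogram law lowers the quadratic by
    -- `‖p n - p k‖ ^ 2 / 8`; hence a minimizing sequence is Cauchy.
    have h3 := hm ((1 / 2 : ℝ) • (p n + p k))
      (m + 1 / ((N : ℝ) + 1) - ‖p n - p k‖ ^ 2 / 8) (fun a => by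
        have ha := hp n a
        have hb := hp k a
        have hpar := parallelogram_law_with_norm ℝ (p n) (p k)
        rw [inner_smul_left, inner_add_left, norm_smul, mul_pow]
        norm_num
        norm_num at ha hb h1 h2
        nlinarith)
    linarith
  have hlim : Filter.Tendsto (fun N : ℕ => 1 / ((N : ℝ) + 1)) Filter.atTop (nhds 0) :=
    tendsto_one_div_add_atTop_nhds_zero_nat
  have hcauchy : CauchySeq p := by
    refine cauchySeq_of_le_tendsto_0 (fun N : ℕ => √(8 * (1 / ((N : ℝ) + 1)))) ?_ ?_
    · intro n k N hn hk
      rw [dist_eq_norm]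
      exact Real.le_sqrt_of_sq_le (hdist N n k hn hk)
    · simpa using (hlim.const_mul 8).sqrt
  obtain ⟨q, hq⟩ := cauchySeq_tendsto_of_complete hcauchy
  refine ⟨q, m, fun a => ?_, hm⟩
  have hl : Filter.Tendsto (fun n => inner ℝ (p n) (b a) + c a + ‖p n‖ ^ 2 / 2) Filter.atTop
      (nhds (inner ℝ q (b a) + c a + ‖q‖ ^ 2 / 2)) :=
    (((hq.inner tendsto_const_nhds).add_const _).add ((hq.norm.pow 2).div_const 2))
  have hr : Filter.Tendsto (fun n : ℕ => m + 1 / ((n : ℝ) + 1)) Filter.atTop (nhds m) := by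
    simpa using hlim.const_add m
  exact le_of_tendsto_of_tendsto' hl hr (fun n => hp n a)

/-- First-order optimality at the minimizer of a supremum of affine functions plus `½‖·‖²`. -/
theorem exists_variational_sup_affine {ι : Type*} (b : ι → F) (c : ι → ℝ) (m₀ : ℝ)
    (hne : ∃ p t, ∀ a, inner ℝ p (b a) + c a + ‖p‖ ^ 2 / 2 ≤ t)
    (hbd : ∀ p t, (∀ a, inner ℝ p (b a) + c a + ‖p‖ ^ 2 / 2 ≤ t) → m₀ ≤ t) :
    ∃ p r, (∀ a, inner ℝ p (b a) + c a ≤ r) ∧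
      ∀ q s, (∀ a, inner ℝ q (b a) + c a ≤ s) → r + ‖p‖ ^ 2 - inner ℝ p q ≤ s := by
  obtain ⟨p, t, hp, hmin⟩ := exists_minimizer_sup_affine b c m₀ hne hbd
  refine ⟨p, t - ‖p‖ ^ 2 / 2, fun a => by linarith [hp a], fun q s hq => ?_⟩
  -- Minimality is tested along the segment from `p` to `q`; dividing by `ε` leaves an error of
  -- order `ε`.
  have key : ∀ ε : ℝ, 0 < ε → ε ≤ 1 →
      t - ‖p‖ ^ 2 / 2 + ‖p‖ ^ 2 - inner ℝ p q ≤ s + ε * (‖q - p‖ ^ 2 / 2) := by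
    intro ε h0 h1
    have hn : ‖p + ε • (q - p)‖ ^ 2
        = ‖p‖ ^ 2 + 2 * (ε * (inner ℝ p q - ‖p‖ ^ 2)) + ε ^ 2 * ‖q - p‖ ^ 2 := by
      rw [norm_add_sq_real, inner_smul_right, inner_sub_right, real_inner_self_eq_norm_sq,
        norm_smul, mul_pow, Real.norm_eq_abs, sq_abs]
    have h := hmin (p + ε • (q - p))
      ((1 - ε) * (t - ‖p‖ ^ 2 / 2) + ε * s + ‖p + ε • (q - p)‖ ^ 2 / 2) (fun a => by
        have ha : (1 - ε) * (inner ℝ p (b a) + c a) ≤ (1 - ε) * (t - ‖p‖ ^ 2 / 2) :=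
          mul_le_mul_of_nonneg_left (by linarith [hp a]) (by linarith)
        have hb := mul_le_mul_of_nonneg_left (hq a) h0.le
        rw [inner_add_left, inner_smul_left, inner_sub_left]
        simp only [conj_trivial]
        linarith)
    rw [hn] at h
    refine le_of_mul_le_mul_left ?_ h0
    linarith
  have hlim : Filter.Tendsto (fun ε : ℝ => s + ε * (‖q - p‖ ^ 2 / 2)) (nhdsWithin 0 (Set.Ioi 0))
      (nhds s) := by
    have : Continuous (fun ε : ℝ => s + ε * (‖q - p‖ ^ 2 / 2)) := by fun_prop
    simpa using (this.tendsto 0).mono_left nhdsWithin_le_nhds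
  refine ge_of_tendsto hlim ?_
  filter_upwards [Ioc_mem_nhdsGT (zero_lt_one' ℝ)] with ε hε
  exact key ε hε.1 hε.2

end Minimization

section Hilbert

variable {E : Type*} [NormedAddCommGroup E] [InnerProductSpace ℝ E]

/-! ### Maximal monotonicity and Minty's theorem -/

namespace MaximallyMonotone

theorem inner_nonneg {A : E → Set E} (hA : MaximallyMonotone A) {x u y v : E} (hx : u ∈ A x)
    (hy : v ∈ A y) : 0 ≤ inner ℝ (x - y) (u - v) :=
  (hA x u).1 hx y v hy

theorem exists_mem {A : E → Set E} (hA : MaximallyMonotone A) : ∃ x u, u ∈ A x := by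
  by_contra! h
  exact h 0 0 ((hA 0 0).2 fun y v hv => absurd hv (h y v))

theorem exists_inner_neg {A : E → Set E} (hA : MaximallyMonotone A) {x u : E} (h : u ∉ A x) :
    ∃ y v, v ∈ A y ∧ inner ℝ (x - y) (u - v) < 0 := by
  rw [hA x u] at h
  push Not at h
  exact h

/-- Either `(x, u)` lies in the graph and is its own witness, or maximality gives a strict one.
Consequently the Fitzpatrick function dominates the pairing, and in a product the other components
cannot spoil a strict violation in one of them. -/
theorem exists_inner_nonpos {A : E → Set E} (hA : MaximallyMonotone A) (x u : E) :
    ∃ y v, v ∈ A y ∧ inner ℝ (x - y) (u - v) ≤ 0 := by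
  by_cases h : u ∈ A x
  · exact ⟨x, u, h, by simp⟩
  · obtain ⟨y, v, hv, hlt⟩ := hA.exists_inner_neg h
    exact ⟨y, v, hv, hlt.le⟩

/-- Maximal monotonicity, split into monotonicity and maximality. -/
theorem of_monotone_of_maximal {A : E → Set E} (hmono : ∀ x u y v : E, u ∈ A x → v ∈ A y →
    0 ≤ inner ℝ (x - y) (u - v))
    (hmax : ∀ x u : E, (∀ y v : E, v ∈ A y → 0 ≤ inner ℝ (x - y) (u - v)) → u ∈ A x) :
    MaximallyMonotone A :=
  fun x u => ⟨fun h y v hv => hmono x u y v h hv, hmax x u⟩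

/-- The case `γ = 1`, `w = 0` of Minty's theorem. The Fitzpatrick function is the supremum of the
affine functions given by `b` and `c`; it dominates the pairing, and `hG` bounds it by the pairing
on the graph. -/
theorem exists_neg_mem [CompleteSpace E] {A : E → Set E} (hA : MaximallyMonotone A) :
    ∃ x, -x ∈ A x := by
  let ι := {a : E × E // a.2 ∈ A a.1}
  let b : ι → WithLp 2 (E × E) := fun a => WithLp.toLp 2 (a.1.2, a.1.1)
  let c : ι → ℝ := fun a => -inner ℝ a.1.1 a.1.2
  have haff : ∀ (p : WithLp 2 (E × E)) (a : ι), inner ℝ p (b a) + c a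
      = inner ℝ p.fst p.snd - inner ℝ (p.fst - a.1.1) (p.snd - a.1.2) := by
    intro p a
    simp only [inner_eq_fst_add_snd, b, c, WithLp.toLp_fst, WithLp.toLp_snd, inner_sub_left, inner_sub_right,
      real_inner_comm p.snd a.1.1]
    ring
  have hnorm : ∀ p : WithLp 2 (E × E), ‖p‖ ^ 2 = ‖p.fst‖ ^ 2 + ‖p.snd‖ ^ 2 :=
    WithLp.prod_norm_sq_eq_of_L2
  have hF : ∀ (p : WithLp 2 (E × E)) (r : ℝ), (∀ a, inner ℝ p (b a) + c a ≤ r) →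
      inner ℝ p.fst p.snd ≤ r := by
    intro p r h
    obtain ⟨y, v, hv, hle⟩ := hA.exists_inner_nonpos p.fst p.snd
    have := h ⟨(y, v), hv⟩
    rw [haff] at this
    linarith
  have hG : ∀ y v, v ∈ A y → ∀ a, inner ℝ (WithLp.toLp 2 (y, v)) (b a) + c a ≤ inner ℝ y v := by
    intro y v hv a
    rw [haff]
    have := hA.inner_nonneg hv a.2
    rw [WithLp.toLp_fst, WithLp.toLp_snd]
    linarith
  -- The lower bound `0` holds because the pairing plus half the squared norm is `‖p.fst + p.snd‖ ^
  -- 2 / 2`.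
  obtain ⟨p, r, hp, hopt⟩ := exists_variational_sup_affine b c 0
    (by
      obtain ⟨y, v, hv⟩ := hA.exists_mem
      exact ⟨WithLp.toLp 2 (y, v), _, fun a => add_le_add_left (hG y v hv a) _⟩)
    (by
      intro p t h
      have h1 := hF p (t - ‖p‖ ^ 2 / 2) (fun a => by linarith [h a])
      have h2 := norm_add_sq_real p.fst p.snd
      rw [hnorm] at h1
      nlinarith [sq_nonneg ‖p.fst + p.snd‖])
  have hr := hF p r hp
  have hsq := norm_add_sq_real p.fst p.snd
  have hkey : ∀ y v, v ∈ A y →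
      ‖p.fst + p.snd‖ ^ 2 ≤ inner ℝ (-p.snd - y) (-p.fst - v) := by
    intro y v hv
    have h : r + (‖p.fst‖ ^ 2 + ‖p.snd‖ ^ 2) - (inner ℝ p.fst y + inner ℝ p.snd v)
        ≤ inner ℝ y v := by
      rw [← hnorm]
      exact hopt (WithLp.toLp 2 (y, v)) _ (hG y v hv)
    simp only [inner_sub_left, inner_sub_right, inner_neg_left, inner_neg_right,
      real_inner_comm p.fst p.snd, real_inner_comm p.fst y]
    linarith
  have hmem : -p.fst ∈ A (-p.snd) :=
    (hA _ _).2 fun y v hv => (sq_nonneg _).trans (hkey y v hv)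
  -- Testing `hkey` at the graph point just found makes its right side vanish, forcing `p.snd =
  -- -p.fst`.
  have h0 := hkey _ _ hmem
  simp only [sub_self, inner_zero_left] at h0
  have hsum : p.fst + p.snd = 0 := by
    rw [← norm_eq_zero]
    exact pow_eq_zero_iff two_ne_zero |>.1 (le_antisymm h0 (sq_nonneg _))
  refine ⟨p.fst, ?_⟩
  rwa [neg_eq_of_add_eq_zero_left hsum] at hmem

/-- **Minty's theorem**: `Id + γ A` is surjective. -/
theorem exists_add_smul_eq [CompleteSpace E] {A : E → Set E} (hA : MaximallyMonotone A) {γ : ℝ}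
    (hγ : 0 < γ) (w : E) : ∃ y v, v ∈ A y ∧ y + γ • v = w := by
  -- This operator is `γ A - w`, so `-x` in its value at `x` means `w ∈ x + γ A x`.
  have hA' : MaximallyMonotone (fun y => {v | γ⁻¹ • (v + w) ∈ A y}) := by
    have hinner : ∀ x u y v : E, inner ℝ (x - y) (γ⁻¹ • (u + w) - γ⁻¹ • (v + w))
        = γ⁻¹ * inner ℝ (x - y) (u - v) := by
      intro x u y v
      rw [← smul_sub, inner_smul_right, add_sub_add_right_eq_sub]
    refine of_monotone_of_maximal (fun x u y v hu hv => ?_) (fun x u h => ?_)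
    · have := hA.inner_nonneg hu hv
      rw [hinner] at this
      exact nonneg_of_mul_nonneg_right this (inv_pos.2 hγ)
    · refine (hA _ _).2 fun y v hv => ?_
      have hv' : γ⁻¹ • ((γ • v - w) + w) = v := by
        rw [sub_add_cancel, inv_smul_smul₀ hγ.ne']
      have := h y (γ • v - w) (by simpa only [Set.mem_ofPred_eq, hv'] using hv)
      rw [← hv', hinner]
      exact mul_nonneg (inv_pos.2 hγ).le this
  obtain ⟨x, hx⟩ := hA'.exists_neg_mem
  exact ⟨x, _, hx, by rw [smul_inv_smul₀ hγ.ne']; abel⟩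

end MaximallyMonotone

theorem mem_add_singleton_iff {V : Type*} [AddCommGroup V] {S : Set V} {a u : V} :
    u ∈ S + {a} ↔ u - a ∈ S := by
  simp [Set.add_singleton, sub_eq_add_neg]

/-! ### Perturbations, zeros and products -/

namespace MaximallyMonotone

/-- The sum of a maximally monotone operator and a monotone, one-sided Lipschitzian map. -/
theorem add_singleton [CompleteSpace E] {A : E → Set E} (hA : MaximallyMonotone A) {T : E → E}
    (hT : MonotoneMap T) {c : ℝ}
    (hc : ∀ x y, inner ℝ (x - y) (T x - T y) ≤ c * ‖x - y‖ ^ 2) :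
    MaximallyMonotone (fun x => A x + {T x}) := by
  refine of_monotone_of_maximal (fun x u y v hu hv => ?_) (fun x u h => ?_)
  · rw [mem_add_singleton_iff] at hu hv
    have h1 := hA.inner_nonneg hu hv
    have h2 := hT x y
    have h3 : u - v = (u - T x - (v - T y)) + (T x - T y) := by abel
    rw [h3, inner_add_right]
    exact add_nonneg h1 h2
  · rw [mem_add_singleton_iff]
    -- With `γ⁻¹ = |c| + 1 > c`, the Minty point `y` satisfies `(|c| + 1) * ‖x - y‖ ^ 2 ≤ c * ‖x -
    -- y‖ ^ 2`, whence `y = x`.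
    set γ : ℝ := (|c| + 1)⁻¹
    have hγ : 0 < γ := by positivity
    obtain ⟨y, v, hv, hyv⟩ := hA.exists_add_smul_eq hγ (x + γ • (u - T x))
    have hxy : u - T x - v = -((|c| + 1) • (x - y)) := by
      have : x - y = -(γ • (u - T x - v)) := by
        rw [smul_sub, sub_eq_iff_eq_add, ← add_right_cancel_iff (a := γ • (u - T x)), ← hyv]
        abel
      rw [this, smul_neg, neg_neg, smul_inv_smul₀ (by positivity)]
    have h1 := h y (v + T y) (mem_add_singleton_iff.2 (by simpa using hv))
    have h2 : u - (v + T y) = (u - T x - v) + (T x - T y) := by abel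
    rw [h2, inner_add_right, hxy, inner_neg_right, inner_smul_right,
      real_inner_self_eq_norm_sq] at h1
    have h3 := hc x y
    have h4 : ‖x - y‖ ^ 2 ≤ 0 := by nlinarith [le_abs_self c, sq_nonneg ‖x - y‖]
    have h5 : x - y = 0 := by
      rw [← norm_eq_zero]
      exact pow_eq_zero_iff two_ne_zero |>.1 (le_antisymm h4 (sq_nonneg _))
    rw [h5, smul_zero, neg_zero, sub_eq_zero] at hxy
    rw [sub_eq_zero.1 h5, ← sub_eq_zero.1 h5, hxy, sub_eq_zero.1 h5]
    exact hv

theorem isClosed_zer {A : E → Set E} (hA : MaximallyMonotone A) : IsClosed (zer A) := by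
  have : zer A = ⋂ (y) (v) (_ : v ∈ A y), {x | 0 ≤ inner ℝ (x - y) (0 - v)} := by
    ext x
    simp only [zer, Set.mem_ofPred_eq, Set.mem_iInter]
    exact hA x 0
  rw [this]
  refine isClosed_iInter fun y => isClosed_iInter fun v => isClosed_iInter fun _ => ?_
  exact isClosed_le continuous_const (by fun_prop)

theorem convex_zer {A : E → Set E} (hA : MaximallyMonotone A) : Convex ℝ (zer A) := by
  intro x hx x' hx' a b ha hb hab
  refine (hA _ _).2 fun y v hv => ?_
  have h : a • x + b • x' - y = a • (x - y) + b • (x' - y) := by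
    rw [smul_sub, smul_sub, sub_add_sub_comm, ← add_smul, hab, one_smul]
  rw [h, inner_add_left, inner_smul_left, inner_smul_left]
  exact add_nonneg (mul_nonneg ha (hA.inner_nonneg hx hv)) (mul_nonneg hb (hA.inner_nonneg hx' hv))

theorem zero : MaximallyMonotone (fun _ : E => ({0} : Set E)) := by
  refine of_monotone_of_maximal (fun x u y v hu hv => ?_) (fun x u h => ?_)
  · rw [Set.mem_singleton_iff.1 hu, Set.mem_singleton_iff.1 hv]
    simp
  · have := h (x + u) 0 rfl
    simpa using this

theorem prod {F : Type*} [NormedAddCommGroup F] [InnerProductSpace ℝ F] {A : E → Set E}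
    {B : F → Set F} (hA : MaximallyMonotone A) (hB : MaximallyMonotone B) :
    MaximallyMonotone (fun p : WithLp 2 (E × F) =>
      {q : WithLp 2 (E × F) | q.fst ∈ A p.fst ∧ q.snd ∈ B p.snd}) := by
  refine of_monotone_of_maximal (fun x u y v hu hv => ?_) (fun x u h => ?_)
  · rw [inner_eq_fst_add_snd]
    exact add_nonneg (hA.inner_nonneg hu.1 hv.1) (hB.inner_nonneg hu.2 hv.2)
  · have key : ∀ y v z w, v ∈ A y → w ∈ B z →
        0 ≤ inner ℝ (x.fst - y) (u.fst - v) + inner ℝ (x.snd - z) (u.snd - w) := by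
      intro y v z w hv hw
      have := h (WithLp.toLp 2 (y, z)) (WithLp.toLp 2 (v, w)) ⟨hv, hw⟩
      rwa [inner_eq_fst_add_snd] at this
    constructor
    · by_contra hn
      obtain ⟨y, v, hv, hlt⟩ := hA.exists_inner_neg hn
      obtain ⟨z, w, hw, hle⟩ := hB.exists_inner_nonpos x.snd u.snd
      linarith [key y v z w hv hw]
    · by_contra hn
      obtain ⟨z, w, hw, hlt⟩ := hB.exists_inner_neg hn
      obtain ⟨y, v, hv, hle⟩ := hA.exists_inner_nonpos x.fst u.fst
      linarith [key y v z w hv hw]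

theorem pi {ι : Type*} [Fintype ι] {V : ι → Type*} [∀ i, NormedAddCommGroup (V i)]
    [∀ i, InnerProductSpace ℝ (V i)] {A : ∀ i, V i → Set (V i)}
    (hA : ∀ i, MaximallyMonotone (A i)) :
    MaximallyMonotone (fun p : PiLp 2 V => {q : PiLp 2 V | ∀ i, q i ∈ A i (p i)}) := by
  refine of_monotone_of_maximal (fun x u y v hu hv => ?_) (fun x u h i => ?_)
  · rw [PiLp.inner_apply]
    exact Finset.sum_nonneg fun i _ => (hA i).inner_nonneg (hu i) (hv i)
  · by_contra hn
    have hex : ∀ j, ∃ y v, v ∈ A j y ∧ inner ℝ (x j - y) (u j - v) ≤ 0 ∧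
        (j = i → inner ℝ (x j - y) (u j - v) < 0) := by
      intro j
      by_cases hj : u j ∈ A j (x j)
      · exact ⟨x j, u j, hj, by simp, by rintro rfl; exact absurd hj hn⟩
      · obtain ⟨y, v, hv, hlt⟩ := (hA j).exists_inner_neg hj
        exact ⟨y, v, hv, hlt.le, fun _ => hlt⟩
    choose y v hv hle hlt using hex
    have h0 := h (WithLp.toLp 2 y) (WithLp.toLp 2 v) hv
    rw [PiLp.inner_apply] at h0
    exact absurd h0 (not_le.2 (Finset.sum_neg' (fun j _ => hle j) ⟨i, Finset.mem_univ i, hlt i rfl⟩))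

end MaximallyMonotone

theorem inner_le_of_lipschitzWith {C : E → E} {β : NNReal} (hC : LipschitzWith β C) (x y : E) :
    inner ℝ (x - y) (C x - C y) ≤ β * ‖x - y‖ ^ 2 := by
  have h1 := real_inner_le_norm (x - y) (C x - C y)
  have h2 := hC.norm_sub_le x y
  nlinarith [norm_nonneg (x - y)]

namespace Cocoercive

theorem monotoneMap {α : ℝ} {C : E → E} (hC : Cocoercive α C) : MonotoneMap C :=
  fun x y => (mul_nonneg hC.1.le (sq_nonneg _)).trans (hC.2 x y)

theorem lipschitzWith {α : ℝ} {C : E → E} (hC : Cocoercive α C) :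
    LipschitzWith ⟨α⁻¹, (inv_pos.2 hC.1).le⟩ C := by
  refine LipschitzWith.of_dist_le_mul fun x y => ?_
  rw [dist_eq_norm, dist_eq_norm]
  change _ ≤ α⁻¹ * _
  rw [← div_eq_inv_mul, le_div_iff₀ hC.1]
  have h1 := (hC.2 x y).trans (real_inner_le_norm _ _)
  rcases (norm_nonneg (C x - C y)).eq_or_lt with h0 | h0
  · rw [← h0]
    simp
  · nlinarith

end Cocoercive

theorem MaximallyMonotone.add_cocoercive_add_lipschitz [CompleteSpace E] {A : E → Set E}
    (hA : MaximallyMonotone A) {C Q : E → E} {α : ℝ} {β : NNReal} (hC : Cocoercive α C)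
    (hQ : MonotoneMap Q) (hQl : LipschitzWith β Q) :
    MaximallyMonotone (A + ofMap C + ofMap Q) :=
  (hA.add_singleton hC.monotoneMap (inner_le_of_lipschitzWith hC.lipschitzWith)).add_singleton
    hQ (inner_le_of_lipschitzWith hQl)

/-- Two decompositions `y + z = y' + z'` of one point give `y - y' = -(z - z')`, so monotonicity of
`B` contradicts strict monotonicity of `D⁻¹` when the values differ. -/
theorem StrictlyMonotone.atMostSingleValued_parallelSum {B D : E → Set E}
    (hB : MaximallyMonotone B) (hD : StrictlyMonotone (inverse D)) :
    AtMostSingleValued (parallelSum B D) := by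
  rintro w v ⟨y, hy, z, hz, hyz⟩ v' ⟨y', hy', z', hz', hyz'⟩
  by_contra hne
  have h1 : 0 ≤ inner ℝ (y - y') (v - v') := hB.inner_nonneg hy hy'
  have h2 := hD v z v' z' hz hz' hne
  have h3 : y - y' = -(z - z') := by
    rw [eq_neg_iff_add_eq_zero, sub_add_sub_comm, sub_eq_zero]
    exact hyz.trans hyz'.symm
  rw [h3, inner_neg_left, real_inner_comm] at h1
  linarith

end Hilbert

end SetOp

/-! ### Maximal monotonicity of the saddle operator -/

namespace InclusionSystem

open SetOp

variable {I K : Type*} [Fintype I] [Fintype K]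
  {H : I → Type*} [∀ i, NormedAddCommGroup (H i)] [∀ i, InnerProductSpace ℝ (H i)]
  {G : K → Type*} [∀ k, NormedAddCommGroup (G k)] [∀ k, InnerProductSpace ℝ (G k)]

theorem sumL_sub (M : InclusionSystem H G) (x x' : PiLp 2 H) (k : K) :
    M.sumL (x - x') k = M.sumL x k - M.sumL x' k := by
  simp [sumL, Finset.sum_sub_distrib]

variable [∀ k, CompleteSpace (G k)]

theorem B_maximallyMonotone (M : InclusionSystem H G) (k : K) : MaximallyMonotone (M.B k) :=
  (M.Bm_maximallyMonotone k).add_cocoercive_add_lipschitz (M.Bc_cocoercive k) (M.Bl_monotone k)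
    (M.Bl_lipschitz k)

theorem D_maximallyMonotone (M : InclusionSystem H G) (k : K) : MaximallyMonotone (M.D k) :=
  (M.Dm_maximallyMonotone k).add_cocoercive_add_lipschitz (M.Dc_cocoercive k) (M.Dl_monotone k)
    (M.Dl_lipschitz k)

variable [∀ i, CompleteSpace (H i)]

/-- The single-valued part of the saddle operator that couples the components. -/
noncomputable def coupling (M : InclusionSystem H G) (p : SaddleSpace H G) : SaddleSpace H G :=
  WithLp.toLp 2 (WithLp.toLp 2 (fun i => M.R i p.fst - M.s i + M.sumLAdj p.snd.snd.snd i),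
    WithLp.toLp 2 (-p.snd.snd.snd, WithLp.toLp 2 (-p.snd.snd.snd,
      WithLp.toLp 2 (fun k => M.r k + p.snd.fst k + p.snd.snd.fst k - M.sumL p.fst k))))

theorem sumLAdj_sub (M : InclusionSystem H G) (v v' : PiLp 2 G) (i : I) :
    M.sumLAdj (v - v') i = M.sumLAdj v i - M.sumLAdj v' i := by
  simp [sumLAdj, Finset.sum_sub_distrib]

theorem sum_inner_sumLAdj (M : InclusionSystem H G) (x : PiLp 2 H) (v : PiLp 2 G) :
    ∑ i, inner ℝ (x i) (M.sumLAdj v i) = ∑ k, inner ℝ (v k) (M.sumL x k) := by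
  simp only [sumLAdj, sumL, inner_sum, ContinuousLinearMap.adjoint_inner_right]
  rw [Finset.sum_comm]
  simp only [real_inner_comm]

/-- The constants `s`, `r` drop out of differences; the `L` and `L*` terms cancel by adjointness,
and the `±v` terms cancel against `y + z`. -/
theorem inner_coupling_sub (M : InclusionSystem H G) (p q : SaddleSpace H G) :
    inner ℝ (p - q) (M.coupling p - M.coupling q)
      = inner ℝ (p.fst - q.fst) (WithLp.toLp 2 (fun i => M.R i p.fst)
          - WithLp.toLp 2 (fun i => M.R i q.fst)) := by
  have h1 : (M.coupling p - M.coupling q).fst = (WithLp.toLp 2 (fun i => M.R i p.fst)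
          - WithLp.toLp 2 (fun i => M.R i q.fst))
        + WithLp.toLp 2 (M.sumLAdj (p.snd.snd.snd - q.snd.snd.snd)) := by
    ext i
    simp only [coupling, WithLp.toLp_fst, WithLp.sub_fst, PiLp.sub_apply, PiLp.add_apply, sumLAdj_sub]
    abel
  have h2 : (M.coupling p - M.coupling q).snd.fst = -(p.snd.snd.snd - q.snd.snd.snd) := by
    simp only [coupling, WithLp.toLp_fst, WithLp.toLp_snd, WithLp.sub_fst, WithLp.sub_snd]
    abel
  have h3 : (M.coupling p - M.coupling q).snd.snd.fst = -(p.snd.snd.snd - q.snd.snd.snd) := by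
    simp only [coupling, WithLp.toLp_fst, WithLp.toLp_snd, WithLp.sub_fst, WithLp.sub_snd]
    abel
  have h4 : (M.coupling p - M.coupling q).snd.snd.snd = (p.snd.fst - q.snd.fst)
        + (p.snd.snd.fst - q.snd.snd.fst) - WithLp.toLp 2 (M.sumL (p.fst - q.fst)) := by
    ext k
    simp only [coupling, WithLp.toLp_snd, WithLp.sub_snd, PiLp.sub_apply, PiLp.add_apply, sumL_sub]
    abel
  have h5 : inner ℝ (p.fst - q.fst)
        (WithLp.toLp 2 (M.sumLAdj (p.snd.snd.snd - q.snd.snd.snd)) : PiLp 2 H)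
      = inner ℝ (p.snd.snd.snd - q.snd.snd.snd)
        (WithLp.toLp 2 (M.sumL (p.fst - q.fst)) : PiLp 2 G) := by
    rw [PiLp.inner_apply, PiLp.inner_apply]
    exact M.sum_inner_sumLAdj _ _
  rw [inner_eq_fst_add_snd, inner_eq_fst_add_snd, inner_eq_fst_add_snd]
  change inner ℝ (p.fst - q.fst) (M.coupling p - M.coupling q).fst
    + (inner ℝ (p.snd.fst - q.snd.fst) (M.coupling p - M.coupling q).snd.fst
      + (inner ℝ (p.snd.snd.fst - q.snd.snd.fst) (M.coupling p - M.coupling q).snd.snd.fst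
        + inner ℝ (p.snd.snd.snd - q.snd.snd.snd) (M.coupling p - M.coupling q).snd.snd.snd)) = _
  rw [h1, h2, h3, h4, inner_add_right (p.fst - q.fst), inner_neg_right, inner_neg_right,
    inner_sub_right (p.snd.snd.snd - q.snd.snd.snd) (_ + _),
    inner_add_right (p.snd.snd.snd - q.snd.snd.snd), h5, real_inner_comm (p.snd.fst - q.snd.fst),
    real_inner_comm (p.snd.snd.fst - q.snd.snd.fst)]
  ring

theorem monotoneMap_coupling (M : InclusionSystem H G) : MonotoneMap M.coupling := by
  intro p q
  rw [inner_coupling_sub]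
  exact M.R_monotone p.fst q.fst

theorem inner_coupling_sub_le (M : InclusionSystem H G) (p q : SaddleSpace H G) :
    inner ℝ (p - q) (M.coupling p - M.coupling q) ≤ M.χ * ‖p - q‖ ^ 2 := by
  rw [inner_coupling_sub]
  refine (inner_le_of_lipschitzWith M.R_lipschitz p.fst q.fst).trans ?_
  have h : ‖p.fst - q.fst‖ ^ 2 ≤ ‖p - q‖ ^ 2 := by
    rw [WithLp.prod_norm_sq_eq_of_L2 (p - q)]
    exact le_add_of_nonneg_right (sq_nonneg _)
  exact mul_le_mul_of_nonneg_left h M.χ.2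

theorem saddle_maximallyMonotone (M : InclusionSystem H G) : MaximallyMonotone M.saddle := by
  have hprod := (MaximallyMonotone.pi fun i =>
      (M.A_maximallyMonotone i).add_cocoercive_add_lipschitz (M.C_cocoercive i) (M.Q_monotone i)
        (M.Q_lipschitz i)).prod
    ((MaximallyMonotone.pi M.B_maximallyMonotone).prod
      ((MaximallyMonotone.pi M.D_maximallyMonotone).prod
        (MaximallyMonotone.zero (E := PiLp 2 G))))
  convert hprod.add_singleton M.monotoneMap_coupling M.inner_coupling_sub_le using 1
  funext p
  ext q
  rw [mem_add_singleton_iff]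
  refine and_congr (forall_congr' fun i => ?_) (and_congr (forall_congr' fun k => ?_)
    (and_congr (forall_congr' fun k => ?_) ?_))
  · change q.fst i ∈ _ ↔ q.fst i - (M.R i p.fst - M.s i + M.sumLAdj p.snd.snd.snd i) ∈
      M.A i (p.fst i) + {M.C i (p.fst i)} + {M.Q i (p.fst i)}
    rw [mem_add_singleton_iff, add_comm {-M.s i}, mem_add_singleton_iff, primalOp,
      mem_add_singleton_iff]
    congr! 1
    abel
  · change q.snd.fst k ∈ _ ↔ q.snd.fst k - (-p.snd.snd.snd k) ∈ M.B k (p.snd.fst k)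
    rw [mem_add_singleton_iff]
  · change q.snd.snd.fst k ∈ _ ↔ q.snd.snd.fst k - (-p.snd.snd.snd k) ∈ M.D k (p.snd.snd.fst k)
    rw [mem_add_singleton_iff]
  · change _ ↔ (q - M.coupling p).snd.snd.snd = 0
    rw [WithLp.sub_snd, WithLp.sub_snd, WithLp.sub_snd, sub_eq_zero, PiLp.ext_iff]
    rfl

/-! ### Zeros, Kuhn–Tucker points, primal and dual solutions -/

theorem mem_zer_saddle_iff (M : InclusionSystem H G) (p : SaddleSpace H G) :
    p ∈ zer M.saddle ↔
      (∀ i, M.s i - M.sumLAdj p.snd.snd.snd i ∈ M.primalOp p.fst i) ∧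
      (∀ k, p.snd.snd.snd k ∈ M.B k (p.snd.fst k)) ∧
      (∀ k, p.snd.snd.snd k ∈ M.D k (p.snd.snd.fst k)) ∧
      ∀ k, p.snd.fst k + p.snd.snd.fst k = M.sumL p.fst k - M.r k := by
  refine and_congr (forall_congr' fun i => ?_) (and_congr (forall_congr' fun k => ?_)
    (and_congr (forall_congr' fun k => ?_) (forall_congr' fun k => ?_)))
  · change (0 : H i) ∈ _ ↔ _
    rw [mem_add_singleton_iff, add_comm {-M.s i}, mem_add_singleton_iff]
    congr! 1
    abel
  · change (0 : G k) ∈ _ ↔ _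
    rw [mem_add_singleton_iff, zero_sub, neg_neg]
  · change (0 : G k) ∈ _ ↔ _
    rw [mem_add_singleton_iff, zero_sub, neg_neg]
  · change (0 : G k) = _ ↔ _
    rw [eq_comm, sub_eq_zero, eq_sub_iff_add_eq, add_comm _ (M.r k), add_assoc]

theorem mem_kuhnTucker_of_mem_zer_saddle (M : InclusionSystem H G) {p : SaddleSpace H G}
    (hp : p ∈ zer M.saddle) : (p.fst, p.snd.snd.snd) ∈ M.kuhnTucker := by
  rw [mem_zer_saddle_iff] at hp
  exact ⟨hp.1, fun k => ⟨_, hp.2.1 k, _, hp.2.2.1 k, hp.2.2.2 k⟩⟩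

theorem kuhnTucker_subset (M : InclusionSystem H G) :
    M.kuhnTucker ⊆ M.primalSolutions ×ˢ M.dualSolutions := by
  rintro ⟨x, v⟩ ⟨hx, hv⟩
  refine ⟨fun i => ⟨_, hx i, M.sumLAdj v i, ?_, sub_add_cancel _ _⟩, x, hx, hv⟩
  exact Set.finsetSum_mem_finsetSum _ _ _ fun k _ => Set.mem_image_of_mem _ (hv k)

theorem kuhnTucker_nonempty_of_dualSolutions_nonempty (M : InclusionSystem H G)
    (h : M.dualSolutions.Nonempty) : M.kuhnTucker.Nonempty := by
  obtain ⟨v, x, hx, hv⟩ := h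
  exact ⟨(x, v), hx, hv⟩

theorem zer_saddle_nonempty_of_kuhnTucker_nonempty (M : InclusionSystem H G)
    (h : M.kuhnTucker.Nonempty) : (zer M.saddle).Nonempty := by
  obtain ⟨⟨x, v⟩, hx, hv⟩ := h
  choose y hy z hz hyz using hv
  refine ⟨WithLp.toLp 2 (x, WithLp.toLp 2 (WithLp.toLp 2 y, WithLp.toLp 2 (WithLp.toLp 2 z, v))),
    ?_⟩
  rw [mem_zer_saddle_iff]
  exact ⟨hx, hy, hz, hyz⟩

/-- A primal solution for which the dual selections can be made independently of `i` yields a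
Kuhn–Tucker point. -/
theorem kuhnTucker_nonempty_of_selection (M : InclusionSystem H G) {x : PiLp 2 H}
    (hx : x ∈ M.primalSolutions)
    (hsel : ∀ w : ∀ (_ : I) (k : K), G k,
      (∀ i k, w i k ∈ parallelSum (M.B k) (M.D k) (M.sumL x k - M.r k)) →
      ∃ v : ∀ k, G k, (∀ k, v k ∈ parallelSum (M.B k) (M.D k) (M.sumL x k - M.r k)) ∧
        ∀ i k, ContinuousLinearMap.adjoint (M.L k i) (v k)
          = ContinuousLinearMap.adjoint (M.L k i) (w i k)) :
    M.kuhnTucker.Nonempty := by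
  have hex : ∀ i, ∃ w : ∀ k, G k,
      (∀ k, w k ∈ parallelSum (M.B k) (M.D k) (M.sumL x k - M.r k)) ∧
      M.s i - ∑ k, ContinuousLinearMap.adjoint (M.L k i) (w k) ∈ M.primalOp x i := by
    intro i
    obtain ⟨a, ha, c, hc, hac⟩ := hx i
    obtain ⟨g, hg, rfl⟩ := (Set.mem_fintype_sum _ _).1 hc
    choose w hw hwg using hg
    refine ⟨w, hw, ?_⟩
    simp only [hwg]
    rwa [← hac, add_sub_cancel_right]
  choose w hw hws using hex
  obtain ⟨v, hv, hvw⟩ := hsel w hw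
  refine ⟨(x, WithLp.toLp 2 v), fun i => ?_, hv⟩
  have : M.sumLAdj (WithLp.toLp 2 v) i = ∑ k, ContinuousLinearMap.adjoint (M.L k i) (w i k) :=
    Finset.sum_congr rfl fun k _ => hvw i k
  rw [this]
  exact hws i

theorem kuhnTucker_nonempty_of_atMostSingleValued [Nonempty I] (M : InclusionSystem H G)
    (h : ∀ k, AtMostSingleValued (parallelSum (M.B k) (M.D k)))
    (hP : M.primalSolutions.Nonempty) : M.kuhnTucker.Nonempty := by
  obtain ⟨x, hx⟩ := hP
  let i₀ := Classical.arbitrary I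
  exact M.kuhnTucker_nonempty_of_selection hx fun w hw =>
    ⟨w i₀, hw i₀, fun i k => congrArg _ (h k _ (hw i₀ k) (hw i k))⟩

theorem kuhnTucker_nonempty_of_card_eq_one (M : InclusionSystem H G) (h : Fintype.card I = 1)
    (hP : M.primalSolutions.Nonempty) : M.kuhnTucker.Nonempty := by
  obtain ⟨x, hx⟩ := hP
  obtain ⟨i₀, hi₀⟩ := Fintype.card_eq_one_iff.1 h
  exact M.kuhnTucker_nonempty_of_selection hx fun w hw =>
    ⟨w i₀, hw i₀, fun i k => by rw [hi₀ i]⟩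

/-- At `k = e j` only the index `j` sees the dual component through `L`, so the selection made for
`j` serves every `i`; outside the range of `e` all selections agree. -/
theorem kuhnTucker_nonempty_of_embedding [Nonempty I] (M : InclusionSystem H G) (e : I ↪ K)
    (h : ∀ k, k ∉ Set.range e → AtMostSingleValued (parallelSum (M.B k) (M.D k)))
    (hL : ∀ i j : I, j ≠ i → M.L (e j) i = 0)
    (hP : M.primalSolutions.Nonempty) : M.kuhnTucker.Nonempty := by
  obtain ⟨x, hx⟩ := hP
  have hf : ∀ k, ∃ j : I, k ∈ Set.range e → e j = k := by
    intro k
    by_cases hk : k ∈ Set.range e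
    · obtain ⟨j, hj⟩ := hk
      exact ⟨j, fun _ => hj⟩
    · exact ⟨Classical.arbitrary I, fun hk' => absurd hk' hk⟩
  choose f hf using hf
  refine M.kuhnTucker_nonempty_of_selection hx fun w hw =>
    ⟨fun k => w (f k) k, fun k => hw _ k, fun i k => ?_⟩
  by_cases hk : k ∈ Set.range e
  · by_cases hi : f k = i
    · subst hi
      rfl
    · have := hL i (f k) hi
      rw [hf k hk] at this
      simp [this]
  · exact congrArg _ (h k hk _ (hw _ k) (hw i k))

end InclusionSystem

theorem proposition1 {I K : Type*} [Fintype I] [Nonempty I] [Fintype K]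
    {H : I → Type*} [∀ i, NormedAddCommGroup (H i)] [∀ i, InnerProductSpace ℝ (H i)]
    [∀ i, CompleteSpace (H i)]
    {G : K → Type*} [∀ k, NormedAddCommGroup (G k)] [∀ k, InnerProductSpace ℝ (G k)]
    [∀ k, CompleteSpace (G k)]
    (M : InclusionSystem H G) :
    SetOp.MaximallyMonotone M.saddle ∧
    (IsClosed (SetOp.zer M.saddle) ∧ Convex ℝ (SetOp.zer M.saddle)) ∧
    ((∀ p ∈ SetOp.zer M.saddle, (p.fst, p.snd.snd.snd) ∈ M.kuhnTucker) ∧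
      M.kuhnTucker ⊆ M.primalSolutions ×ˢ M.dualSolutions) ∧
    ((M.dualSolutions.Nonempty ↔ (SetOp.zer M.saddle).Nonempty) ∧
      ((SetOp.zer M.saddle).Nonempty ↔ M.kuhnTucker.Nonempty) ∧
      (M.kuhnTucker.Nonempty → M.primalSolutions.Nonempty)) ∧
    ((Fintype.card I = 1 ∨
      (∀ k, SetOp.AtMostSingleValued (SetOp.parallelSum (M.B k) (M.D k))) ∨
      (∀ k, SetOp.StrictlyMonotone (SetOp.inverse (M.D k))) ∨
      -- `I ⊂ K`, the inclusion being given by an injection `e`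
      (∃ e : I ↪ K,
        (∀ k, k ∉ Set.range e →
          SetOp.AtMostSingleValued (SetOp.parallelSum (M.B k) (M.D k))) ∧
        ∀ i j : I, j ≠ i → M.L (e j) i = 0)) →
      (M.primalSolutions.Nonempty → M.kuhnTucker.Nonempty)) := by
  have hS := M.saddle_maximallyMonotone
  refine ⟨hS, ⟨hS.isClosed_zer, hS.convex_zer⟩,
    ⟨fun p hp => M.mem_kuhnTucker_of_mem_zer_saddle hp, M.kuhnTucker_subset⟩,
    ⟨⟨fun h => M.zer_saddle_nonempty_of_kuhnTucker_nonempty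
        (M.kuhnTucker_nonempty_of_dualSolutions_nonempty h), ?_⟩,
      ⟨?_, M.zer_saddle_nonempty_of_kuhnTucker_nonempty⟩, ?_⟩, ?_⟩
  · rintro ⟨p, hp⟩
    exact ⟨_, (M.kuhnTucker_subset (M.mem_kuhnTucker_of_mem_zer_saddle hp)).2⟩
  · rintro ⟨p, hp⟩
    exact ⟨_, M.mem_kuhnTucker_of_mem_zer_saddle hp⟩
  · rintro ⟨p, hp⟩
    exact ⟨_, (M.kuhnTucker_subset hp).1⟩
  · rintro (h | h | h | ⟨e, h, hL⟩) hP
    · exact M.kuhnTucker_nonempty_of_card_eq_one h hP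
    · exact M.kuhnTucker_nonempty_of_atMostSingleValued h hP
    · exact M.kuhnTucker_nonempty_of_atMostSingleValued
        (fun k => SetOp.StrictlyMonotone.atMostSingleValued_parallelSum
          (M.B_maximallyMonotone k) (h k)) hP
    · exact M.kuhnTucker_nonempty_of_embedding e h hL hP
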